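/- Let $\mathbb D$ be the open unit disc, $\mathbb T$ the unit circle, $\pi(z,w)=(z+w,zw)$, let $\mathbb G=\pi(\mathbb D\times\mathbb D)\subset\mathbb C^2$ be the symmetrized bidisc, $\partial\mathbb G$ its topological boundary and $b\mathbb G=\pi(\mathbb T\times\mathbb T)$ its distinguished boundary. For a polynomial $\xi\in\mathbb C[s,p]$ let $Z(\xi)\subset\mathbb C^2$ be its zero set; $Z(\xi)$ is called distinguished (with respect to $\mathbb G$) if $Z(\xi)\cap\mathbb G\neq\emptyset$ and $Z(\xi)\cap\partial\mathbb G=Z(\xi)\cap b\mathbb G$. A rational function on $\mathbb C^2$, written as $g/h$ with $g,h$ relatively prime polynomials, is called regular if $h\neq0$ on $\overline{\mathbb G}$. It is inner on $\mathbb G$ if it is analytic on $\mathbb G$ with values in $\overline{\mathbb D}$ and $\lim_{r\to1^-}|f(r\zeta_1+r\zeta_2,r^2\zeta_1\zeta_2)|=1$ for almost all $(\zeta_1,\zeta_2)\in\mathbb T^2$. The $2$-degree $\operatorname{2-deg}q=(d_1,d_2)$ of a polynomial $q\in\mathbb C[z,w]$ consists of its degrees in $z$ and in $w$, and its reflection is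 the polynomial $\widetilde q(z,w)=z^{d_1}w^{d_2}\,\overline{q(1/\bar z,1/\bar w)}$. The $2$-degree of a rational function of $(z,w)$ is the $2$-degree of its numerator in lowest terms. Pairs of integers are compared componentwise. **Proposition.** Let $\xi\in\mathbb C[s,p]$ be such that $\mathcal W=Z(\xi)$ is an irreducible algebraic variety that is distinguished with respect to $\mathbb G$. Let $f$ be a regular rational inner function on $\mathbb G$ such that $$f\circ\pi(z,w)=(zw)^m\,\frac{\widetilde{\eta\circ\pi}(z,w)}{\eta\circ\pi(z,w)}$$ as rational functions, for some integer $m\ge0$ and some nonzero polynomial $\eta\in\mathbb C[s,p]$. Suppose that $\operatorname{2-deg}(\xi\circ\pi)\le\operatorname{2-deg}(f\circ\pi)$. Then for each $(s,p)\in\mathbb G\setminus(\mathbb G\cap\mathcal W)$ there exists a regular rational inner function $g$ on $\mathbb G$ such that $g=f$ on $\mathcal W\cap\mathbb G$ but $g(s,p)\neq f(s,p)$. -/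

import Mathlib

open Filter Topology MeasureTheory

noncomputable section

namespace SymBidisc

/-- Points of `ℂ²`; only the topology and the analytic structure of `ℂ²` are used. -/
abbrev C2 : Type := Fin 2 → ℂ

/-- Two-variable complex polynomials. -/
abbrev Poly2 : Type := MvPolynomial (Fin 2) ℂ

/-- Two-variable complex rational functions. -/
abbrev Rat2 : Type := FractionRing Poly2

/-- The symmetrization map `π (z, w) = (z + w, z w)`. -/
def symMap (z w : ℂ) : C2 := ![z + w, z * w]

/-- The symmetrized bidisc. -/
def G : Set C2 := {x | ∃ z w : ℂ, ‖z‖ < 1 ∧ ‖w‖ < 1 ∧ symMap z w = x}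

/-- The distinguished boundary `π (𝕋 × 𝕋)` of the symmetrized bidisc. -/
def bG : Set C2 := {x | ∃ z w : ℂ, ‖z‖ = 1 ∧ ‖w‖ = 1 ∧ symMap z w = x}

/-- The zero set in `ℂ²` of a polynomial. -/
def zeroSet (ξ : Poly2) : Set C2 := {x | MvPolynomial.eval x ξ = 0}

/-- An algebraic set is irreducible if its vanishing ideal is prime. -/
def IsIrreducibleVariety (W : Set C2) : Prop :=
  (MvPolynomial.vanishingIdeal ℂ W).IsPrime

/-- The variety `W` is distinguished with respect to the symmetrized bidisc: it meets `G`, and it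
meets the topological boundary of `G` only in the distinguished boundary. -/
def IsDistinguished (W : Set C2) : Prop :=
  (W ∩ G).Nonempty ∧ W ∩ frontier G = W ∩ bG

/-- The Schur class of `G`: analytic functions from `G` to the closed unit disc. -/
def IsSchur (f : C2 → ℂ) : Prop :=
  AnalyticOnNhd ℂ f G ∧ ∀ x ∈ G, ‖f x‖ ≤ 1

/-- Inner functions on `G`: Schur functions whose radial limits are unimodular at almost every
`(ζ₁, ζ₂) = (exp (i θ₁), exp (i θ₂))`. -/
def IsInner (f : C2 → ℂ) : Prop :=
  IsSchur f ∧
    ∀ᵐ θ : ℝ × ℝ, Tendsto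
      (fun r : ℝ => ‖f (symMap ((r : ℂ) * (Circle.exp θ.1 : ℂ)) ((r : ℂ) * (Circle.exp θ.2 : ℂ)))‖)
      (𝓝[<] 1) (𝓝 1)

/-- The numerator of a rational function in lowest terms. -/
def ratNum (f : Rat2) : Poly2 := IsFractionRing.num Poly2 f

/-- The denominator of a rational function in lowest terms. -/
def ratDen (f : Rat2) : Poly2 := (IsFractionRing.den Poly2 f : Poly2)

/-- The value at a point of a rational function, computed from its expression in lowest terms
(meaningful where the denominator in lowest terms does not vanish). -/
def ratEval (f : Rat2) (x : C2) : ℂ :=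
  MvPolynomial.eval x (ratNum f) / MvPolynomial.eval x (ratDen f)

/-- A rational function is regular if its denominator in lowest terms has no zero on the closure
of `G`. -/
def IsRegular (f : Rat2) : Prop :=
  ∀ x ∈ closure G, MvPolynomial.eval x (ratDen f) ≠ 0

/-- Regular rational inner functions on `G`. -/
def IsRegularRationalInner (f : Rat2) : Prop :=
  IsRegular f ∧ IsInner (ratEval f)

/-- Composition of polynomials with `π`: the substitution `(s, p) = (z + w, z w)`. -/
def compPi : Poly2 →+* Poly2 :=
  (MvPolynomial.aeval
    ![MvPolynomial.X 0 + MvPolynomial.X 1, MvPolynomial.X 0 * MvPolynomial.X 1] :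
      Poly2 →ₐ[ℂ] Poly2).toRingHom

theorem eval_compPi (ξ : Poly2) (x : C2) :
    MvPolynomial.eval x (compPi ξ) = MvPolynomial.eval (symMap (x 0) (x 1)) ξ := by
  induction ξ using MvPolynomial.induction_on with
  | C a => simp [compPi]
  | add p q hp hq => simp [hp, hq]
  | mul_X p i hp =>
    rw [map_mul, map_mul, map_mul, hp]
    fin_cases i <;> simp [compPi, symMap]

theorem compPi_injective : Function.Injective compPi := by
  intro a b h
  apply MvPolynomial.funext
  intro x
  obtain ⟨z, w, rfl⟩ : ∃ z w : ℂ, symMap z w = x := by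
    obtain ⟨d, hd⟩ := IsAlgClosed.exists_pow_nat_eq (x 0 ^ 2 - 4 * x 1) (n := 2) (by norm_num)
    refine ⟨(x 0 + d) / 2, (x 0 - d) / 2, ?_⟩
    ext i
    fin_cases i
    · simp [symMap]; ring
    · simp [symMap]; linear_combination (-1 / 4 : ℂ) * hd
  have := congrArg (MvPolynomial.eval ![z, w]) h
  simpa [eval_compPi] using this

/-- Composition of rational functions with `π`: the field embedding that extends `compPi`. -/
def ratCompPi : Rat2 →+* Rat2 :=
  IsFractionRing.map (K := Rat2) (L := Rat2) compPi_injective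

/-- The `2`-degree of a polynomial: its degrees in the two variables. Pairs are compared
componentwise. -/
def twoDeg (ξ : Poly2) : ℕ × ℕ := (ξ.degreeOf 0, ξ.degreeOf 1)

/-- The `2`-degree of a rational function: the `2`-degree of its numerator in lowest terms. -/
def ratTwoDeg (f : Rat2) : ℕ × ℕ := twoDeg (ratNum f)

/-- The reflection `z ^ d₁ * w ^ d₂ * conj (ξ (1 / conj z, 1 / conj w))` of a polynomial `ξ` of
`2`-degree `(d₁, d₂)`: the coefficient `a` of `z ^ i * w ^ j` becomes the coefficient `conj a` of
`z ^ (d₁ - i) * w ^ (d₂ - j)`. -/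
def reflection (ξ : Poly2) : Poly2 :=
  ∑ e ∈ ξ.support,
    MvPolynomial.C (starRingEnd ℂ (ξ.coeff e)) *
      MvPolynomial.X 0 ^ (ξ.degreeOf 0 - e 0) * MvPolynomial.X 1 ^ (ξ.degreeOf 1 - e 1)

theorem eval_reflection (ξ : Poly2) (z w : ℂ) (hz : z ≠ 0) (hw : w ≠ 0) :
    MvPolynomial.eval ![z, w] (reflection ξ) =
      z ^ (twoDeg ξ).1 * w ^ (twoDeg ξ).2 *
        starRingEnd ℂ (MvPolynomial.eval ![1 / starRingEnd ℂ z, 1 / starRingEnd ℂ w] ξ) := by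
  rw [reflection, map_sum, MvPolynomial.eval_eq', map_sum, Finset.mul_sum]
  refine Finset.sum_congr rfl fun e he => ?_
  have h0 : e 0 ≤ ξ.degreeOf 0 := MvPolynomial.degreeOf_le_iff.mp le_rfl e he
  have h1 : e 1 ≤ ξ.degreeOf 1 := MvPolynomial.degreeOf_le_iff.mp le_rfl e he
  simp [twoDeg, Fin.prod_univ_two, pow_sub₀ _ hz h0, pow_sub₀ _ hw h1]
  ring

/-- The rational function `(z w) ^ m * reflection (η ∘ π) / (η ∘ π)`. -/
def blaschkeForm (m : ℕ) (η : Poly2) : Rat2 :=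
  algebraMap Poly2 Rat2
      ((MvPolynomial.X 0 * MvPolynomial.X 1) ^ m * reflection (compPi η)) /
    algebraMap Poly2 Rat2 (compPi η)

end SymBidisc

end

noncomputable section

namespace SymBidisc

/-! Write `f = N / D` in lowest terms and `n = deg N` (total degree). On `bG` one has `conj p = 1 /
p` and `conj s = s / p`, so `p ^ n * conj F` agrees there with a polynomial, `refl n F`, when `deg F
≤ n`. Since `f` is unimodular on `bG`, coprimality and a degree count give `N = c * p ^ n * conj D`
there, with `|c| = 1` (`eval_num_eq_of_norm_eq`).

The variety is the zero set of a prime factor `F` of `ξ`. Being distinguished, it meets `bG` in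
infinitely many points, at which `refl F` vanishes as well. Hence `F` divides `refl F`, and `refl F
= κ * F` with `κ ≠ 0` (`dvd_refl_of_isDistinguished`, `refl_eq_C_mul_of_dvd`).

The 2-degree hypothesis yields `deg F ≤ n` (`degreeOf_compPi`). With `k = n - deg F`, take `g = (N +
c * conj t * κ * F) / (D + t * p ^ k * F)`. On `bG` its numerator is `c * p ^ n` times the conjugate
of its denominator. For small `t` the denominator has no zero on the compact closure of `G`, so `g`
is regular and inner by the maximum principle. It agrees with `f` where `F = 0`, and a suitable `t`
separates the two values at the given point. -/

/-! ### Reflection on the distinguished boundary -/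

/-- The reflection, seen in the coordinates `(s, p)`, with respect to the degree `n`. -/
def refl (n : ℕ) (F : Poly2) : Poly2 :=
  ∑ e ∈ F.support,
    MvPolynomial.C (starRingEnd ℂ (F.coeff e)) * MvPolynomial.X 0 ^ e 0 *
      MvPolynomial.X 1 ^ (n - (e 0 + e 1))

theorem sum_le_totalDegree {F : Poly2} {e : Fin 2 →₀ ℕ} (he : e ∈ F.support) :
    e 0 + e 1 ≤ F.totalDegree := by
  have := MvPolynomial.le_totalDegree he
  rwa [Finsupp.sum_fintype _ _ (fun _ => rfl), Fin.sum_univ_two] at this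

theorem mul_conj_of_norm_one {z : ℂ} (hz : ‖z‖ = 1) : z * starRingEnd ℂ z = 1 := by
  rw [Complex.mul_conj, Complex.normSq_eq_norm_sq, hz]; simp

theorem conj_symm_of_mem_bG {x : C2} (hx : x ∈ bG) :
    x 1 * starRingEnd ℂ (x 1) = 1 ∧ x 1 * starRingEnd ℂ (x 0) = x 0 := by
  obtain ⟨z, w, hz, hw, rfl⟩ := hx
  have h1 := mul_conj_of_norm_one hz
  have h2 := mul_conj_of_norm_one hw
  simp only [symMap, Matrix.cons_val_zero, Matrix.cons_val_one, map_mul, map_add]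
  constructor
  · linear_combination w * starRingEnd ℂ w * h1 + h2
  · linear_combination w * h1 + z * h2

theorem norm_snd_of_mem_bG {x : C2} (hx : x ∈ bG) : ‖x 1‖ = 1 := by
  obtain ⟨z, w, hz, hw, rfl⟩ := hx
  simp [symMap, hz, hw]

/-- On `bG`, `conj s = s / p` and `conj p = 1 / p` turn `p ^ n * conj (s ^ i * p ^ j)` into `s ^ i *
p ^ (n - i - j)`. The degree bound keeps the natural subtraction in `refl` from truncating. -/
theorem eval_refl {n : ℕ} {F : Poly2} (hF : F.totalDegree ≤ n) {x : C2} (hx : x ∈ bG) :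
    MvPolynomial.eval x (refl n F) = x 1 ^ n * starRingEnd ℂ (MvPolynomial.eval x F) := by
  obtain ⟨h1, h0⟩ := conj_symm_of_mem_bG hx
  rw [refl, map_sum, MvPolynomial.eval_eq', map_sum, Finset.mul_sum]
  refine Finset.sum_congr rfl fun e he => ?_
  have hle := (sum_le_totalDegree he).trans hF
  obtain ⟨k, rfl⟩ := Nat.exists_eq_add_of_le hle
  simp only [map_mul, map_pow, MvPolynomial.eval_C, MvPolynomial.eval_X, Fin.prod_univ_two,
    Nat.add_sub_cancel_left]
  calc _ = starRingEnd ℂ (F.coeff e) * (x 1 * starRingEnd ℂ (x 0)) ^ e 0 * x 1 ^ k *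
        (x 1 * starRingEnd ℂ (x 1)) ^ e 1 := by rw [h0, h1]; ring
    _ = _ := by ring

theorem totalDegree_refl_le {n : ℕ} {F : Poly2} (hF : F.totalDegree ≤ n) :
    (refl n F).totalDegree ≤ n := by
  refine MvPolynomial.totalDegree_finsetSum_le fun e he => ?_
  have hle := (sum_le_totalDegree he).trans hF
  refine (MvPolynomial.totalDegree_mul _ _).trans ?_
  rw [MvPolynomial.totalDegree_X_pow]
  have := MvPolynomial.totalDegree_mul
    (MvPolynomial.C (starRingEnd ℂ (F.coeff e)) : Poly2) (MvPolynomial.X 0 ^ e 0)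
  rw [MvPolynomial.totalDegree_X_pow, MvPolynomial.totalDegree_C] at this
  omega

theorem infinite_unit_circle : {z : ℂ | ‖z‖ = 1}.Infinite := by
  have h := isPreconnected_sphere (E := ℂ) (by simp) 0 1
  have he : Metric.sphere (0 : ℂ) 1 = {z : ℂ | ‖z‖ = 1} := by ext; simp
  rw [he] at h
  exact h.infinite_of_nontrivial ⟨1, by simp, -1, by simp, by norm_num⟩

/-- After composition with `π` the two polynomials agree on a product of two infinite sets, the
torus. -/
theorem eq_of_eqOn_bG {F H : Poly2}
    (h : ∀ x ∈ bG, MvPolynomial.eval x F = MvPolynomial.eval x H) : F = H := by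
  apply compPi_injective
  refine MvPolynomial.funext_set (fun _ => {z : ℂ | ‖z‖ = 1}) ?_ ?_
  · exact fun _ => infinite_unit_circle
  · intro x hx
    rw [eval_compPi, eval_compPi]
    exact h _ ⟨x 0, x 1, hx 0 trivial, hx 1 trivial, rfl⟩

theorem symMap_mem_bG {z w : ℂ} (hz : ‖z‖ = 1) (hw : ‖w‖ = 1) : symMap z w ∈ bG :=
  ⟨z, w, hz, hw, rfl⟩

theorem refl_ne_zero {n : ℕ} {F : Poly2} (hF : F.totalDegree ≤ n) (h0 : F ≠ 0) :
    refl n F ≠ 0 := by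
  intro h
  apply h0
  refine eq_of_eqOn_bG fun x hx => ?_
  have := eval_refl hF hx
  rw [h, map_zero, eq_comm, mul_eq_zero] at this
  have hp : x 1 ≠ 0 := by
    intro h0; have := norm_snd_of_mem_bG hx; simp [h0] at this
  simpa [hp] using this

/-- A polynomial that divides its reflection is proportional to it. -/
theorem refl_eq_C_mul_of_dvd {F : Poly2} (h0 : F ≠ 0) (h : F ∣ refl F.totalDegree F) :
    ∃ κ : ℂ, κ ≠ 0 ∧ refl F.totalDegree F = MvPolynomial.C κ * F := by
  obtain ⟨u, hu⟩ := h
  have hr := refl_ne_zero le_rfl h0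
  have hu0 : u ≠ 0 := by rintro rfl; simp [hu] at hr
  -- Reflection does not raise the degree, so the cofactor `u` has degree zero.
  have hd := totalDegree_refl_le (le_refl F.totalDegree)
  rw [hu, MvPolynomial.totalDegree_mul_of_isDomain h0 hu0] at hd
  have hu' := MvPolynomial.totalDegree_eq_zero_iff_eq_C.mp (by omega : u.totalDegree = 0)
  refine ⟨u.coeff 0, ?_, ?_⟩
  · intro hc; rw [hc, map_zero] at hu'; exact hu0 hu'
  · rw [hu, ← hu', mul_comm]

/-- If `N / D` is in lowest terms and unimodular on the distinguished boundary, then `N` is a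
multiple of a reflection of `D`. -/
theorem eval_num_eq_of_norm_eq {N D : Poly2} (hcop : IsRelPrime N D)
    (hD : ∀ x ∈ bG, MvPolynomial.eval x D ≠ 0) (hD0 : MvPolynomial.eval 0 D ≠ 0)
    (hND : ∀ x ∈ bG, ‖MvPolynomial.eval x N‖ = ‖MvPolynomial.eval x D‖) :
    D.totalDegree ≤ N.totalDegree ∧ ∃ c : ℂ, ‖c‖ = 1 ∧ ∀ x ∈ bG,
      MvPolynomial.eval x N =
        c * (x 1 ^ N.totalDegree * starRingEnd ℂ (MvPolynomial.eval x D)) := by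
  set n := N.totalDegree with hn
  set k := D.totalDegree with hk
  have h11 : symMap 1 1 ∈ bG := symMap_mem_bG (by simp) (by simp)
  have hN0 : N ≠ 0 := by
    rintro rfl
    have := hND _ h11
    rw [map_zero, norm_zero, eq_comm, norm_eq_zero] at this
    exact hD _ h11 this
  have hDne : D ≠ 0 := by rintro rfl; simp at hD0
  have hRN := refl_ne_zero hn.ge hN0
  -- The identity `|N|² = |D|²` on `bG`, multiplied by `p ^ (n + k)`.
  have key : MvPolynomial.X 1 ^ k * (N * refl n N) = MvPolynomial.X 1 ^ n * (D * refl k D) := by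
    refine eq_of_eqOn_bG fun x hx => ?_
    simp only [map_mul, map_pow, MvPolynomial.eval_X, eval_refl hn.ge hx, eval_refl hk.ge hx]
    have h := hND x hx
    have h' : MvPolynomial.eval x N * starRingEnd ℂ (MvPolynomial.eval x N) =
        MvPolynomial.eval x D * starRingEnd ℂ (MvPolynomial.eval x D) := by
      rw [Complex.mul_conj, Complex.mul_conj, Complex.normSq_eq_norm_sq,
        Complex.normSq_eq_norm_sq, h]
    linear_combination x 1 ^ k * x 1 ^ n * h'
  -- If `p` divided `D`, then `D` would vanish at the origin.
  have hX : IsRelPrime D (MvPolynomial.X 1 : Poly2) := by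
    have hp : Prime (MvPolynomial.X 1 : Poly2) := MvPolynomial.X_prime
    refine (hp.irreducible.isRelPrime_iff_not_dvd.mpr ?_).symm
    rintro ⟨q, rfl⟩
    simp at hD0
  have hdvd : D ∣ refl n N := by
    have h1 : D ∣ MvPolynomial.X 1 ^ k * (N * refl n N) := ⟨MvPolynomial.X 1 ^ n * refl k D, by
      rw [key]; ring⟩
    exact hcop.symm.dvd_of_dvd_mul_left (hX.pow_right.dvd_of_dvd_mul_left h1)
  obtain ⟨u, hu⟩ := hdvd
  have hu0 : u ≠ 0 := by rintro rfl; simp [hu] at hRN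
  have hdeg := totalDegree_refl_le hn.ge
  rw [hu, MvPolynomial.totalDegree_mul_of_isDomain hDne hu0] at hdeg
  have hkn : k ≤ n := by omega
  -- The right side has degree at most `n = deg N`, which forces `u` to be constant.
  have key2 : N * u = MvPolynomial.X 1 ^ (n - k) * refl k D := by
    have hne : (MvPolynomial.X 1 ^ k * D : Poly2) ≠ 0 :=
      mul_ne_zero (pow_ne_zero _ (MvPolynomial.X_ne_zero _)) hDne
    apply mul_left_cancel₀ hne
    have : (MvPolynomial.X 1 ^ n : Poly2) = MvPolynomial.X 1 ^ k * MvPolynomial.X 1 ^ (n - k) := by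
      rw [← pow_add, Nat.add_sub_cancel' hkn]
    rw [hu, this] at key
    linear_combination key
  have hdeg2 : (N * u).totalDegree ≤ n := by
    rw [key2]
    refine (MvPolynomial.totalDegree_mul _ _).trans ?_
    rw [MvPolynomial.totalDegree_X_pow]
    have := totalDegree_refl_le hk.ge
    omega
  rw [MvPolynomial.totalDegree_mul_of_isDomain hN0 hu0] at hdeg2
  have hu' := MvPolynomial.totalDegree_eq_zero_iff_eq_C.mp (by omega : u.totalDegree = 0)
  set a := u.coeff 0
  have hev : ∀ x ∈ bG, a * MvPolynomial.eval x N =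
      x 1 ^ n * starRingEnd ℂ (MvPolynomial.eval x D) := by
    intro x hx
    have := congrArg (MvPolynomial.eval x) key2
    rw [hu'] at this
    simp only [map_mul, map_pow, MvPolynomial.eval_X, MvPolynomial.eval_C,
      eval_refl hk.ge hx] at this
    rw [mul_comm, this, ← mul_assoc, ← pow_add, Nat.sub_add_cancel hkn]
  have ha : ‖a‖ = 1 := by
    have h := congrArg norm (hev _ h11)
    rw [norm_mul, norm_mul, norm_pow, norm_snd_of_mem_bG h11, RCLike.norm_conj, hND _ h11,
      one_pow] at h
    exact mul_right_cancel₀ (norm_ne_zero_iff.mpr (hD _ h11)) h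
  have ha0 : a ≠ 0 := by rintro h; simp [h] at ha
  refine ⟨hkn, a⁻¹, by simp [ha], fun x hx => ?_⟩
  rw [← hev x hx, inv_mul_cancel_left₀ ha0]

/-! ### Finiteness of common zeros and propagation of zeros to the circle -/

/-- A prime containing `F` and `H` lies strictly above `(F)`, hence is maximal because the ring has
dimension 2. The ideals of the common zeros are thus among the finitely many minimal primes of `(F,
H)`, and a point is determined by its ideal. -/
theorem finite_common_zeros {F H : Poly2} (hF : Prime F) (hFH : ¬ F ∣ H) :
    {x : C2 | MvPolynomial.eval x F = 0 ∧ MvPolynomial.eval x H = 0}.Finite := by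
  have hmax : ∀ Q : Ideal Poly2, Q.IsPrime → F ∈ Q → H ∈ Q → Q.IsMaximal := by
    intro Q hQ hFQ hHQ
    have hdim : ringKrullDim Poly2 = 2 := by
      rw [MvPolynomial.ringKrullDim_of_isNoetherianRing, ringKrullDim_eq_zero_of_field]
      simp
    have hFp : (Ideal.span {F}).IsPrime := (Ideal.span_singleton_prime hF.ne_zero).mpr hF
    have h1 : (⊥ : Ideal Poly2) < Ideal.span {F} :=
      bot_lt_iff_ne_bot.mpr (by simpa using hF.ne_zero)
    have h2 : Ideal.span {F} < Q := by
      refine lt_of_le_of_ne ((Ideal.span_singleton_le_iff_mem _).mpr hFQ) ?_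
      rintro rfl
      exact hFH (Ideal.mem_span_singleton.mp hHQ)
    obtain ⟨M, hM, hQM⟩ := Ideal.exists_le_maximal Q hQ.ne_top
    rcases lt_or_eq_of_le hQM with hlt | rfl
    · have hMp := hM.isPrime
      have e1 := Ideal.height_add_one_le_of_lt_of_isPrime h1
      have e2 := Ideal.height_add_one_le_of_lt_of_isPrime h2
      have e3 := Ideal.height_add_one_le_of_lt_of_isPrime hlt
      have e4 := Ideal.height_le_ringKrullDim_of_isPrime (I := M)
      rw [hdim] at e4
      have e5 : M.height ≤ 2 := WithBot.coe_le_coe.mp e4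
      have e6 : (3 : ℕ∞) ≤ M.height := by
        calc (3 : ℕ∞) = 0 + 1 + 1 + 1 := by norm_num
          _ ≤ (⊥ : Ideal Poly2).height + 1 + 1 + 1 := by gcongr; exact zero_le
          _ ≤ (Ideal.span {F}).height + 1 + 1 := by gcongr
          _ ≤ Q.height + 1 := by gcongr
          _ ≤ M.height := e3
      exact absurd (e6.trans e5) (by decide)
    · exact hM
  have hfin := Ideal.finite_minimalPrimes_of_isNoetherianRing Poly2 (Ideal.span {F, H})
  refine Set.Finite.of_finite_image (f := fun x : C2 => RingHom.ker (MvPolynomial.eval x))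
    (hfin.subset ?_) ?_
  · rintro _ ⟨x, ⟨hx1, hx2⟩, rfl⟩
    refine ⟨⟨RingHom.ker_isPrime _, ?_⟩, ?_⟩
    · rw [Ideal.span_le]
      rintro _ (rfl | rfl) <;> assumption
    · rintro Q ⟨hQ, hJQ⟩ hle
      have hQm := hmax Q hQ (hJQ (Ideal.subset_span (by simp)))
        (hJQ (Ideal.subset_span (by simp)))
      exact (hQm.eq_of_le (RingHom.ker_isPrime _).ne_top hle).ge
  · intro x _ y _ hxy
    ext i
    have h : (MvPolynomial.X i - MvPolynomial.C (x i) : Poly2) ∈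
        RingHom.ker (MvPolynomial.eval x) := by simp [RingHom.mem_ker]
    have hxy' : RingHom.ker (MvPolynomial.eval x) = RingHom.ker (MvPolynomial.eval y) := hxy
    rw [hxy', RingHom.mem_ker] at h
    simp only [map_sub, MvPolynomial.eval_X, MvPolynomial.eval_C, sub_eq_zero] at h
    exact h.symm

/-- If `f (z, ·)` has no zero on the unit circle for `z` in the disc, and `f` has a zero in the
bidisc, then `f (ζ, ·)` has a zero in the closed disc for every `ζ` in the closed disc. -/
theorem exists_zero_of_no_zero_on_circle {f : ℂ → ℂ → ℂ} (hc : Continuous (Function.uncurry f))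
    (hd : ∀ z, Differentiable ℂ (f z)) (hno : ∀ z w, ‖z‖ < 1 → ‖w‖ = 1 → f z w ≠ 0)
    {z₀ w₀ : ℂ} (hz₀ : ‖z₀‖ < 1) (hw₀ : ‖w₀‖ < 1) (h0 : f z₀ w₀ = 0) {ζ : ℂ} (hζ : ‖ζ‖ ≤ 1) :
    ∃ w, ‖w‖ ≤ 1 ∧ f ζ w = 0 := by
  set T : Set ℂ := {z | ∃ w, ‖w‖ ≤ 1 ∧ f z w = 0} with hT
  have hTc : IsClosed T := by
    rw [← isOpen_compl_iff, isOpen_iff_mem_nhds]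
    intro z hz
    have hz' : ∀ w ∈ Metric.closedBall (0 : ℂ) 1,
        ∀ᶠ q : ℂ × ℂ in 𝓝 (z, w), f q.1 q.2 ≠ 0 := by
      intro w hw
      refine hc.continuousAt.eventually_ne fun h => hz ⟨w, by simpa using hw, h⟩
    filter_upwards [(isCompact_closedBall (0 : ℂ) 1).eventually_forall_of_forall_eventually
      (P := fun z w => f z w ≠ 0) hz']
      with z' h'
    rintro ⟨w, hw, hw'⟩
    exact h' w (by simpa using hw) hw'
  -- Hurwitz's argument: for `z'` near `z`, `|f z' ·|` exceeds `δ / 2` on the circle but is smaller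
  -- at `w`. Without a zero in the closed disc, the maximum principle for `1 / f z'` would be
  -- violated.
  have hTo : IsOpen (T ∩ Metric.ball 0 1) := by
    rw [isOpen_iff_mem_nhds]
    rintro z ⟨⟨w, hw, hzw⟩, hz⟩
    have hz1 : ‖z‖ < 1 := by simpa using hz
    have hfz : ContinuousOn (fun w => ‖f z w‖) (Metric.sphere 0 1) :=
      (hd z).continuous.norm.continuousOn
    obtain ⟨v, hv, hvmin⟩ := (isCompact_sphere (0 : ℂ) 1).exists_isMinOn
      ⟨1, by simp⟩ hfz
    set δ := ‖f z v‖
    have hδ : 0 < δ := norm_pos_iff.mpr (hno z v hz1 (by simpa using hv))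
    have e1 : ∀ w ∈ Metric.sphere (0 : ℂ) 1,
        ∀ᶠ q : ℂ × ℂ in 𝓝 (z, w), δ / 2 < ‖f q.1 q.2‖ := by
      intro w hw
      refine hc.norm.continuousAt.eventually (lt_mem_nhds ?_)
      have : δ ≤ ‖f z w‖ := hvmin hw
      simp only [Function.uncurry]
      linarith
    have e2 : ∀ᶠ z' in 𝓝 z, ‖f z' w‖ < δ / 2 := by
      have hcw : Continuous fun z' => ‖f z' w‖ :=
        (hc.comp (Continuous.prodMk continuous_id continuous_const)).norm
      refine hcw.continuousAt.eventually (gt_mem_nhds ?_)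
      simp only [hzw, norm_zero]; linarith
    filter_upwards [(isCompact_sphere (0 : ℂ) 1).eventually_forall_of_forall_eventually
      (P := fun z w => δ / 2 < ‖f z w‖) e1, e2,
      Metric.isOpen_ball.mem_nhds hz] with z' h1 h2 h3
    refine ⟨?_, h3⟩
    by_contra hz'
    have hne : ∀ w, ‖w‖ ≤ 1 → f z' w ≠ 0 := fun w hw h => hz' ⟨w, hw, h⟩
    have hdc : DiffContOnCl ℂ (fun w => (f z' w)⁻¹) (Metric.ball 0 1) := by
      refine DiffContOnCl.inv (hd z').diffContOnCl fun w hw => hne w ?_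
      rw [closure_ball _ one_ne_zero] at hw
      simpa using hw
    have hle := Complex.norm_le_of_forall_mem_frontier_norm_le Metric.isBounded_ball hdc
      (C := (δ / 2)⁻¹) (fun v hv => by
        rw [frontier_ball _ one_ne_zero] at hv
        rw [norm_inv]
        exact inv_anti₀ (by positivity) (h1 v hv).le) (z := w) (by
          rw [closure_ball _ one_ne_zero]; simpa using hw)
    rw [norm_inv] at hle
    have hpos : 0 < ‖f z' w‖ := norm_pos_iff.mpr (hne w hw)
    exact absurd ((inv_le_inv₀ hpos (by positivity)).mp hle) (not_le.mpr h2)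
  have hsub : Metric.ball (0 : ℂ) 1 ⊆ T ∩ Metric.ball 0 1 := by
    refine (convex_ball (0 : ℂ) 1).isPreconnected.subset_of_closure_inter_subset hTo ?_ ?_
    · exact ⟨z₀, by simpa using hz₀, ⟨w₀, hw₀.le, h0⟩, by simpa using hz₀⟩
    · rintro z ⟨hz, hz'⟩
      exact ⟨hTc.closure_subset (closure_mono Set.inter_subset_left hz), hz'⟩
  have hcl : Metric.closedBall (0 : ℂ) 1 ⊆ T := by
    rw [← closure_ball _ one_ne_zero]
    exact hTc.closure_subset_iff.mpr fun z hz => (hsub hz).1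
  exact hcl (by simpa using hζ)

/-! ### Closure and frontier of `G`; distinguished varieties -/

theorem symMap_eq {z w z' w' : ℂ} (h : symMap z w = symMap z' w') :
    z = z' ∧ w = w' ∨ z = w' ∧ w = z' := by
  have h0 : z + w = z' + w' := by simpa [symMap] using congrFun h 0
  have h1 : z * w = z' * w' := by simpa [symMap] using congrFun h 1
  have h2 : (z - z') * (z - w') = 0 := by linear_combination z * h0 - h1
  rcases mul_eq_zero.mp h2 with h3 | h3
  · exact Or.inl ⟨by linear_combination h3, by linear_combination h0 - h3⟩
  · exact Or.inr ⟨by linear_combination h3, by linear_combination h0 - h3⟩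

theorem continuous_symMap : Continuous fun q : ℂ × ℂ => symMap q.1 q.2 := by
  refine continuous_pi fun i => ?_
  fin_cases i <;> simp [symMap] <;> fun_prop

theorem continuous_eval (F : Poly2) : Continuous fun x : C2 => MvPolynomial.eval x F :=
  MvPolynomial.continuous_eval F

theorem symMap_mem_closure_G {z w : ℂ} (hz : ‖z‖ ≤ 1) (hw : ‖w‖ ≤ 1) :
    symMap z w ∈ closure G := by
  have h : (z, w) ∈ closure (Metric.ball (0 : ℂ) 1 ×ˢ Metric.ball (0 : ℂ) 1) := by
    rw [closure_prod_eq, closure_ball _ one_ne_zero]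
    simp [hz, hw]
  refine map_mem_closure (f := fun q : ℂ × ℂ => symMap q.1 q.2) continuous_symMap h ?_
  rintro ⟨a, b⟩ ⟨ha, hb⟩
  exact ⟨a, b, by simpa using ha, by simpa using hb, rfl⟩

theorem bG_subset_closure_G : bG ⊆ closure G := by
  rintro _ ⟨z, w, hz, hw, rfl⟩
  exact symMap_mem_closure_G hz.le hw.le

theorem isCompact_closure_G : IsCompact (closure G) := by
  have hK : IsCompact ((fun q : ℂ × ℂ => symMap q.1 q.2) ''
      (Metric.closedBall (0 : ℂ) 1 ×ˢ Metric.closedBall (0 : ℂ) 1)) :=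
    ((isCompact_closedBall _ _).prod (isCompact_closedBall _ _)).image continuous_symMap
  refine hK.closure_of_subset ?_
  rintro _ ⟨z, w, hz, hw, rfl⟩
  exact ⟨(z, w), by simp [hz.le, hw.le], rfl⟩

theorem symMap_mem_frontier_G {z w : ℂ} (hz : ‖z‖ ≤ 1) (hw : ‖w‖ ≤ 1)
    (h : ‖z‖ = 1 ∨ ‖w‖ = 1) : symMap z w ∈ frontier G := by
  refine ⟨symMap_mem_closure_G hz hw, fun hi => ?_⟩
  obtain ⟨z', w', hz', hw', he⟩ := interior_subset hi
  rcases symMap_eq he with ⟨rfl, rfl⟩ | ⟨rfl, rfl⟩ <;> rcases h with h | h <;> linarith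

theorem norm_eq_one_of_isDistinguished {W : Set C2} (hW : IsDistinguished W) {z w : ℂ}
    (hz : ‖z‖ ≤ 1) (hw : ‖w‖ ≤ 1) (h : ‖z‖ = 1 ∨ ‖w‖ = 1) (hzw : symMap z w ∈ W) :
    ‖z‖ = 1 ∧ ‖w‖ = 1 := by
  have hm : symMap z w ∈ W ∩ bG := hW.2 ▸ ⟨hzw, symMap_mem_frontier_G hz hw h⟩
  obtain ⟨z', w', hz', hw', he⟩ := hm.2
  rcases symMap_eq he with ⟨rfl, rfl⟩ | ⟨rfl, rfl⟩ <;> exact ⟨by assumption, by assumption⟩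

theorem differentiable_eval (F : Poly2) :
    Differentiable ℂ fun x : C2 => MvPolynomial.eval x F :=
  fun x => (AnalyticOnNhd.eval_mvPolynomial F x trivial).differentiableAt

theorem differentiable_symMap_right (z : ℂ) : Differentiable ℂ (symMap z) := by
  rw [differentiable_pi]
  intro i
  fin_cases i <;> simp [symMap] <;> fun_prop

theorem differentiable_eval_symMap_right (F : Poly2) (z : ℂ) :
    Differentiable ℂ fun w => MvPolynomial.eval (symMap z w) F :=
  (differentiable_eval F).comp (differentiable_symMap_right z)

theorem symMap_comm (z w : ℂ) : symMap z w = symMap w z := by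
  rw [symMap, symMap, add_comm, mul_comm]

/-- Zeros propagate from the bidisc: every `ζ` on the circle has a partner `w` with `π (ζ, w)` in
the variety, and `w` is unimodular because the variety is distinguished. At these points of `bG`
both `F` and its reflection vanish. Each point comes from at most two `ζ`, so there are infinitely
many common zeros. -/
theorem dvd_refl_of_isDistinguished {F : Poly2} (hF : Prime F)
    (hW : IsDistinguished (zeroSet F)) : F ∣ refl F.totalDegree F := by
  by_contra hdvd
  have hfin := finite_common_zeros hF hdvd
  obtain ⟨_, hxF, z₀, w₀, hz₀, hw₀, rfl⟩ := hW.1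
  have hex : ∀ ζ : ℂ, ‖ζ‖ = 1 → ∃ w, ‖w‖ ≤ 1 ∧ MvPolynomial.eval (symMap ζ w) F = 0 := by
    intro ζ hζ
    refine exists_zero_of_no_zero_on_circle
      (f := fun z w => MvPolynomial.eval (symMap z w) F)
      ((continuous_eval F).comp continuous_symMap) (differentiable_eval_symMap_right F) ?_
      hz₀ hw₀ hxF hζ.le
    intro z w hz hw h
    exact hz.ne (norm_eq_one_of_isDistinguished hW hz.le hw.le (Or.inr hw) h).1
  refine infinite_unit_circle ((hfin.biUnion
    (t := fun x => {ζ : ℂ | ∃ w, symMap ζ w = x}) fun x _ => ?_).subset ?_)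
  · by_cases hx : ∃ ζ w, symMap ζ w = x
    · obtain ⟨ζ, w, rfl⟩ := hx
      refine (Set.toFinite {ζ, w}).subset ?_
      rintro ζ' ⟨w', h⟩
      rcases symMap_eq h with ⟨h, -⟩ | ⟨h, -⟩ <;> simp [h]
    · refine Set.finite_empty.subset fun ζ ⟨w, h⟩ => hx ⟨ζ, w, h⟩
  · intro ζ hζ
    obtain ⟨w, hw, h⟩ := hex ζ hζ
    have hw1 := (norm_eq_one_of_isDistinguished hW (le_of_eq hζ) hw (Or.inl hζ) h).2
    refine Set.mem_biUnion (x := symMap ζ w) ⟨h, ?_⟩ ⟨w, rfl⟩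
    rw [eval_refl le_rfl (symMap_mem_bG hζ hw1), h, map_zero, mul_zero]

/-- The frontier point `π (1, 0)` is not in `bG`, so the variety cannot be all of `ℂ²`. -/
theorem ne_zero_of_isDistinguished {ξ : Poly2} (hW : IsDistinguished (zeroSet ξ)) : ξ ≠ 0 := by
  rintro rfl
  have := (norm_eq_one_of_isDistinguished hW (z := 1) (w := 0) (by simp) (by simp)
    (Or.inl (by simp)) (by simp [zeroSet])).2
  simp at this

/-- An irreducible zero set is the zero set of a prime factor. -/
theorem exists_prime_dvd_zeroSet_eq {ξ : Poly2} (h0 : ξ ≠ 0)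
    (hirr : IsIrreducibleVariety (zeroSet ξ)) :
    ∃ F : Poly2, Prime F ∧ F ∣ ξ ∧ zeroSet F = zeroSet ξ := by
  obtain ⟨S, hS, hprod⟩ := UniqueFactorizationMonoid.exists_prime_factors ξ h0
  have hξ : ξ ∈ MvPolynomial.vanishingIdeal ℂ (zeroSet ξ) := by
    rw [MvPolynomial.mem_vanishingIdeal_iff]
    intro x hx
    rw [MvPolynomial.aeval_eq_eval]
    exact hx
  have hm : S.prod ∈ MvPolynomial.vanishingIdeal ℂ (zeroSet ξ) :=
    Ideal.mem_of_dvd _ hprod.symm.dvd hξ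
  obtain ⟨F, hFS, hF⟩ := (Ideal.IsPrime.multiset_prod_mem_iff_exists_mem hirr S).mp hm
  have hdvd : F ∣ ξ := (Multiset.dvd_prod hFS).trans hprod.dvd
  refine ⟨F, hS F hFS, hdvd, Set.Subset.antisymm (fun x hx => ?_) fun x hx => ?_⟩
  · obtain ⟨u, rfl⟩ := hdvd
    have hx' : MvPolynomial.eval x F = 0 := hx
    simp [zeroSet, hx']
  · have := MvPolynomial.mem_vanishingIdeal_iff.mp hF x hx
    rwa [MvPolynomial.aeval_eq_eval] at this

/-! ### Degree of `F ∘ π` in one variable -/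

theorem finSuccEquiv_compPi (F : Poly2) :
    MvPolynomial.finSuccEquiv ℂ 1 (compPi F) = ∑ e ∈ F.support,
      Polynomial.C (MvPolynomial.C (F.coeff e) * MvPolynomial.X 0 ^ e 1) *
        ((Polynomial.X + Polynomial.C (MvPolynomial.X 0)) ^ e 0 * Polynomial.X ^ e 1) := by
  have h1 : MvPolynomial.finSuccEquiv ℂ 1 (MvPolynomial.X 1) =
      Polynomial.C (MvPolynomial.X 0) := MvPolynomial.finSuccEquiv_X_succ (j := 0)
  conv_lhs => rw [F.as_sum]
  rw [map_sum, map_sum]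
  refine Finset.sum_congr rfl fun e _ => ?_
  have h2 : compPi (MvPolynomial.monomial e (F.coeff e)) = MvPolynomial.C (F.coeff e) *
      ((MvPolynomial.X 0 + MvPolynomial.X 1) ^ e 0 *
        (MvPolynomial.X 0 * MvPolynomial.X 1) ^ e 1) := by
    change MvPolynomial.aeval _ _ = _
    rw [MvPolynomial.aeval_monomial, Finsupp.prod_fintype _ _ (fun _ => pow_zero _),
      Fin.prod_univ_two]
    rfl
  rw [h2]
  have h3 : MvPolynomial.finSuccEquiv ℂ 1 (MvPolynomial.C (F.coeff e)) =
      Polynomial.C (MvPolynomial.C (F.coeff e)) := by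
    simp [MvPolynomial.finSuccEquiv_apply]
  simp only [map_mul, map_pow, map_add, h1, h3, MvPolynomial.finSuccEquiv_X_zero]
  ring

/-- Over `ℂ[w]`, the monomial `s ^ i * p ^ j` becomes `w ^ j` times a monic polynomial in `z` of
degree `i + j`. Monomials of top total degree have distinct `j`, so their leading coefficients
cannot cancel. -/
theorem degreeOf_compPi (F : Poly2) : (compPi F).degreeOf 0 = F.totalDegree := by
  rw [← MvPolynomial.natDegree_finSuccEquiv, finSuccEquiv_compPi]
  set M : (Fin 2 →₀ ℕ) → Polynomial (MvPolynomial (Fin 1) ℂ) := fun e =>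
    (Polynomial.X + Polynomial.C (MvPolynomial.X 0)) ^ e 0 * Polynomial.X ^ e 1 with hM
  have hmonic : ∀ e, (M e).Monic := fun e =>
    ((Polynomial.monic_X_add_C _).pow _).mul (Polynomial.monic_X_pow _)
  have hdeg : ∀ e, (M e).natDegree = e 0 + e 1 := by
    intro e
    rw [hM, Polynomial.Monic.natDegree_mul ((Polynomial.monic_X_add_C _).pow _)
      (Polynomial.monic_X_pow _), (Polynomial.monic_X_add_C _).natDegree_pow,
      Polynomial.natDegree_X_add_C, Polynomial.natDegree_X_pow, mul_one]
  apply le_antisymm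
  · refine Polynomial.natDegree_sum_le_of_forall_le _ _ fun e he => ?_
    exact (Polynomial.natDegree_C_mul_le _ _).trans
      ((hdeg e).le.trans (sum_le_totalDegree he))
  · by_cases hF : F = 0
    · simp [hF]
    obtain ⟨e, he, hed⟩ := Finset.exists_mem_eq_sup F.support
      (MvPolynomial.support_nonempty.mpr hF) (fun s : Fin 2 →₀ ℕ => s.sum fun _ k => k)
    have hed' : F.totalDegree = e 0 + e 1 := by
      rw [MvPolynomial.totalDegree, hed, Finsupp.sum_fintype _ _ (fun _ => rfl),
        Fin.sum_univ_two]
    refine Polynomial.le_natDegree_of_ne_zero fun hc => ?_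
    have hc' := congrArg (MvPolynomial.coeff (Finsupp.single 0 (e 1))) hc
    rw [Polynomial.finsetSum_coeff, MvPolynomial.coeff_sum, Finset.sum_eq_single e] at hc'
    · have h1 : (M e).coeff F.totalDegree = 1 := by
        rw [hed', ← hdeg e]; exact hmonic e
      rw [Polynomial.coeff_C_mul, h1, mul_one, MvPolynomial.coeff_C_mul,
        MvPolynomial.coeff_X_pow, if_pos rfl, mul_one, MvPolynomial.coeff_zero] at hc'
      exact MvPolynomial.mem_support_iff.mp he hc'
    · intro e' he' hne
      rw [Polynomial.coeff_C_mul]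
      by_cases hs : e' 0 + e' 1 = F.totalDegree
      · have h1 : (M e').coeff F.totalDegree = 1 := by
          rw [← hs, ← hdeg e']; exact hmonic e'
        rw [h1, mul_one, MvPolynomial.coeff_C_mul, MvPolynomial.coeff_X_pow, if_neg, mul_zero]
        intro h
        have h2 : e' 1 = e 1 := by simpa using DFunLike.congr_fun h 0
        refine hne (Finsupp.ext fun i => ?_)
        fin_cases i
        · change e' 0 = e 0
          omega
        · exact h2
      · rw [Polynomial.coeff_eq_zero_of_natDegree_lt, mul_zero, MvPolynomial.coeff_zero]
        rw [hdeg]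
        exact lt_of_le_of_ne (sum_le_totalDegree he') hs
    · exact fun h => absurd he h

/-! ### Rational functions in lowest terms -/

theorem ratDen_ne_zero (h : Rat2) : ratDen h ≠ 0 :=
  nonZeroDivisors.ne_zero (IsFractionRing.den Poly2 h).2

theorem ratNum_mul_eq {a b : Poly2} (hb : b ≠ 0) :
    ratNum (algebraMap Poly2 Rat2 a / algebraMap Poly2 Rat2 b) * b =
      a * ratDen (algebraMap Poly2 Rat2 a / algebraMap Poly2 Rat2 b) := by
  set h : Rat2 := algebraMap Poly2 Rat2 a / algebraMap Poly2 Rat2 b with hh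
  have h1 : algebraMap Poly2 Rat2 (ratNum h) / algebraMap Poly2 Rat2 (ratDen h) = h :=
    IsFractionRing.mk'_num_den' Poly2 h
  have inj := IsFractionRing.injective Poly2 Rat2
  have hb' : algebraMap Poly2 Rat2 b ≠ 0 := by
    simpa using (map_ne_zero_iff _ inj).mpr hb
  have hd' : algebraMap Poly2 Rat2 (ratDen h) ≠ 0 := by
    simpa using (map_ne_zero_iff _ inj).mpr (ratDen_ne_zero h)
  apply inj
  rw [map_mul, map_mul]
  exact (div_eq_div_iff hd' hb').mp (h1.trans hh)

theorem isRelPrime_num_den (h : Rat2) : IsRelPrime (ratNum h) (ratDen h) :=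
  IsFractionRing.num_den_reduced Poly2 h

theorem ratNum_dvd {a b : Poly2} (hb : b ≠ 0) :
    ratNum (algebraMap Poly2 Rat2 a / algebraMap Poly2 Rat2 b) ∣ a :=
  (isRelPrime_num_den _).dvd_of_dvd_mul_right ⟨b, (ratNum_mul_eq hb).symm⟩

theorem ratDen_dvd {a b : Poly2} (hb : b ≠ 0) :
    ratDen (algebraMap Poly2 Rat2 a / algebraMap Poly2 Rat2 b) ∣ b :=
  (isRelPrime_num_den _).symm.dvd_of_dvd_mul_left
    ⟨a, (ratNum_mul_eq hb).trans (mul_comm _ _)⟩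

theorem eval_ratDen_ne_zero {a b : Poly2} {x : C2} (hx : MvPolynomial.eval x b ≠ 0) :
    MvPolynomial.eval x (ratDen (algebraMap Poly2 Rat2 a / algebraMap Poly2 Rat2 b)) ≠ 0 := by
  have hb : b ≠ 0 := by rintro rfl; simp at hx
  intro h
  obtain ⟨u, hu⟩ := ratDen_dvd (a := a) hb
  rw [hu, map_mul, h, zero_mul] at hx
  exact hx rfl

theorem ratEval_div {a b : Poly2} {x : C2} (hx : MvPolynomial.eval x b ≠ 0) :
    ratEval (algebraMap Poly2 Rat2 a / algebraMap Poly2 Rat2 b) x =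
      MvPolynomial.eval x a / MvPolynomial.eval x b := by
  have hb : b ≠ 0 := by rintro rfl; simp at hx
  have h := congrArg (MvPolynomial.eval x) (ratNum_mul_eq (a := a) hb)
  rw [map_mul, map_mul] at h
  exact (div_eq_div_iff (eval_ratDen_ne_zero hx) hx).mpr h

/-- The degree of the numerator of `f ∘ π` is at most the total degree of the numerator of `f`. -/
theorem ratTwoDeg_ratCompPi_fst_le {f : Rat2} (hf : ratNum f ≠ 0) :
    (ratTwoDeg (ratCompPi f)).1 ≤ (ratNum f).totalDegree := by
  have h1 : algebraMap Poly2 Rat2 (ratNum f) / algebraMap Poly2 Rat2 (ratDen f) = f :=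
    IsFractionRing.mk'_num_den' Poly2 f
  have h2 : ratCompPi f =
      algebraMap Poly2 Rat2 (compPi (ratNum f)) / algebraMap Poly2 Rat2 (compPi (ratDen f)) := by
    conv_lhs => rw [← h1]
    rw [map_div₀]
    simp [ratCompPi, IsFractionRing.map]
  have hd : compPi (ratDen f) ≠ 0 :=
    (map_ne_zero_iff _ compPi_injective).mpr (ratDen_ne_zero f)
  have hn : compPi (ratNum f) ≠ 0 := (map_ne_zero_iff _ compPi_injective).mpr hf
  obtain ⟨u, hu⟩ := ratNum_dvd (a := compPi (ratNum f)) hd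
  rw [← h2] at hu
  rw [← degreeOf_compPi, hu]
  rw [hu] at hn
  rw [MvPolynomial.degreeOf_mul_eq (left_ne_zero_of_mul hn) (right_ne_zero_of_mul hn)]
  exact Nat.le_add_right _ _

/-! ### Inner functions and boundary values -/

/-- Regularity makes the radial limit the value at the boundary point, so equality holds almost
everywhere. Both sides are continuous in the angles, hence it holds everywhere. -/
theorem norm_eval_eq_of_isInner {f : Rat2} (hf : IsRegularRationalInner f) {x : C2}
    (hx : x ∈ bG) :
    ‖MvPolynomial.eval x (ratNum f)‖ = ‖MvPolynomial.eval x (ratDen f)‖ := by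
  obtain ⟨hreg, -, hlim⟩ := hf
  set T : ℝ × ℝ → ℝ → C2 := fun θ r =>
    symMap ((r : ℂ) * (Circle.exp θ.1 : ℂ)) ((r : ℂ) * (Circle.exp θ.2 : ℂ)) with hT
  have hTb : ∀ θ, T θ 1 ∈ bG := fun θ => by
    simp only [hT, Complex.ofReal_one, one_mul]
    exact symMap_mem_bG (Circle.norm_coe _) (Circle.norm_coe _)
  have hTr : ∀ θ, Continuous (T θ) := fun θ =>
    continuous_symMap.comp (f := fun r : ℝ =>
      ((r : ℂ) * (Circle.exp θ.1 : ℂ), (r : ℂ) * (Circle.exp θ.2 : ℂ))) (by fun_prop)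
  have hTθ : Continuous fun θ => T θ 1 :=
    continuous_symMap.comp (f := fun θ : ℝ × ℝ =>
      (((1 : ℝ) : ℂ) * (Circle.exp θ.1 : ℂ), ((1 : ℝ) : ℂ) * (Circle.exp θ.2 : ℂ))) (by fun_prop)
  have hae : (fun θ => ‖MvPolynomial.eval (T θ 1) (ratNum f)‖) =ᵐ[volume]
      fun θ => ‖MvPolynomial.eval (T θ 1) (ratDen f)‖ := by
    filter_upwards [hlim] with θ hθ
    have hD := hreg _ (bG_subset_closure_G (hTb θ))
    have hcont : ContinuousAt (fun r => ‖ratEval f (T θ r)‖) 1 :=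
      (((continuous_eval _).comp (hTr θ)).continuousAt.div
        ((continuous_eval _).comp (hTr θ)).continuousAt hD).norm
    have := tendsto_nhds_unique hθ (hcont.tendsto.mono_left nhdsWithin_le_nhds)
    rw [ratEval, norm_div, eq_comm, div_eq_one_iff_eq (norm_ne_zero_iff.mpr hD)] at this
    exact this
  have heq := (Continuous.ae_eq_iff_eq volume (((continuous_eval _).comp hTθ).norm)
    (((continuous_eval _).comp hTθ).norm)).mp hae
  obtain ⟨z, w, hz, hw, rfl⟩ := hx
  have h := congrFun heq (Complex.arg z, Complex.arg w)
  have hz' : (Circle.exp (Complex.arg z) : ℂ) = z := by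
    have := Complex.norm_mul_exp_arg_mul_I z
    rw [hz] at this
    simpa using this
  have hw' : (Circle.exp (Complex.arg w) : ℂ) = w := by
    have := Complex.norm_mul_exp_arg_mul_I w
    rw [hw] at this
    simpa using this
  simpa only [hT, hz', hw', Complex.ofReal_one, one_mul, Function.comp_apply] using h

/-- The maximum principle in one variable; applied to each variable in turn it carries a bound from
the torus to the bidisc. -/
theorem norm_eval_div_le_of_norm_left_eq_one {N D : Poly2} {C : ℝ} {w : ℂ} (hw : ‖w‖ ≤ 1)
    (hD : ∀ x ∈ closure G, MvPolynomial.eval x D ≠ 0)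
    (hND : ∀ z, ‖z‖ = 1 →
      ‖MvPolynomial.eval (symMap w z) N / MvPolynomial.eval (symMap w z) D‖ ≤ C)
    {z : ℂ} (hz : ‖z‖ ≤ 1) :
    ‖MvPolynomial.eval (symMap w z) N / MvPolynomial.eval (symMap w z) D‖ ≤ C := by
  have hdc : DiffContOnCl ℂ
      (fun z => MvPolynomial.eval (symMap w z) N / MvPolynomial.eval (symMap w z) D)
      (Metric.ball 0 1) := by
    refine DifferentiableOn.diffContOnCl fun v hv => ?_
    rw [closure_ball _ one_ne_zero] at hv
    exact ((differentiable_eval_symMap_right N w v).div (differentiable_eval_symMap_right D w v)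
      (hD _ (symMap_mem_closure_G hw (by simpa using hv)))).differentiableWithinAt
  refine Complex.norm_le_of_forall_mem_frontier_norm_le Metric.isBounded_ball hdc
    (fun v hv => hND v ?_) ?_
  · rw [frontier_ball _ one_ne_zero] at hv
    simpa using hv
  · rw [closure_ball _ one_ne_zero]
    simpa using hz

/-- A quotient of polynomials that is regular on the closure of `G` and unimodular on the
distinguished boundary is a regular rational inner function. -/
theorem isRegularRationalInner_div {N D : Poly2}
    (hD : ∀ x ∈ closure G, MvPolynomial.eval x D ≠ 0)
    (hND : ∀ x ∈ bG, ‖MvPolynomial.eval x N‖ = ‖MvPolynomial.eval x D‖) :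
    IsRegularRationalInner (algebraMap Poly2 Rat2 N / algebraMap Poly2 Rat2 D) := by
  set g : Rat2 := algebraMap Poly2 Rat2 N / algebraMap Poly2 Rat2 D with hg
  have hden : IsRegular g := fun x hx => eval_ratDen_ne_zero (hD x hx)
  have huni : ∀ x ∈ bG, ‖MvPolynomial.eval x N / MvPolynomial.eval x D‖ = 1 := by
    intro x hx
    rw [norm_div, hND x hx, div_self (norm_ne_zero_iff.mpr (hD x (bG_subset_closure_G hx)))]
  refine ⟨hden, ⟨fun x hx => ?_, ?_⟩, Eventually.of_forall fun θ => ?_⟩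
  · exact (AnalyticOnNhd.eval_mvPolynomial _ x trivial).div
      (AnalyticOnNhd.eval_mvPolynomial _ x trivial) (hden x (subset_closure hx))
  · rintro _ ⟨z, w, hz, hw, rfl⟩
    rw [hg, ratEval_div (hD _ (symMap_mem_closure_G hz.le hw.le))]
    refine norm_eval_div_le_of_norm_left_eq_one hz.le hD (fun v hv => ?_) hw.le
    rw [symMap_comm]
    refine norm_eval_div_le_of_norm_left_eq_one hv.le hD (fun u hu => ?_) hz.le
    exact (huni _ (symMap_mem_bG hv hu)).le
  · set T : ℝ → C2 := fun r =>
      symMap ((r : ℂ) * (Circle.exp θ.1 : ℂ)) ((r : ℂ) * (Circle.exp θ.2 : ℂ)) with hT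
    have hTb : T 1 ∈ bG := by
      simp only [hT, Complex.ofReal_one, one_mul]
      exact symMap_mem_bG (Circle.norm_coe _) (Circle.norm_coe _)
    have hTr : Continuous T :=
      continuous_symMap.comp (f := fun r : ℝ =>
        ((r : ℂ) * (Circle.exp θ.1 : ℂ), (r : ℂ) * (Circle.exp θ.2 : ℂ))) (by fun_prop)
    have hcont : ContinuousAt (fun r => ‖ratEval g (T r)‖) 1 :=
      (((continuous_eval _).comp hTr).continuousAt.div
        ((continuous_eval _).comp hTr).continuousAt
        (hden _ (bG_subset_closure_G hTb))).norm
    have h1 : ‖ratEval g (T 1)‖ = 1 := by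
      rw [hg, ratEval_div (hD _ (bG_subset_closure_G hTb)), huni _ hTb]
    have := hcont.tendsto.mono_left (nhdsWithin_le_nhds (s := Set.Iio 1))
    rwa [h1] at this

/-- A polynomial without zeros on the closure of `G` stays so under small perturbations. -/
theorem exists_pos_forall_eval_add_ne_zero {D Q : Poly2}
    (hD : ∀ x ∈ closure G, MvPolynomial.eval x D ≠ 0) :
    ∃ ε : ℝ, 0 < ε ∧ ∀ t : ℂ, ‖t‖ ≤ ε → ∀ x ∈ closure G,
      MvPolynomial.eval x (D + MvPolynomial.C t * Q) ≠ 0 := by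
  have hcont : ContinuousOn (fun x => MvPolynomial.eval x Q / MvPolynomial.eval x D)
      (closure G) :=
    (continuous_eval Q).continuousOn.div (continuous_eval D).continuousOn hD
  obtain ⟨B, hB⟩ := isCompact_closure_G.exists_bound_of_continuousOn hcont
  refine ⟨(|B| + 1)⁻¹, by positivity, fun t ht x hx h => ?_⟩
  have hx' := hD x hx
  have hq : t * (MvPolynomial.eval x Q / MvPolynomial.eval x D) = -1 := by
    simp only [map_add, map_mul, MvPolynomial.eval_C] at h
    field_simp
    linear_combination h
  have h1 := congrArg norm hq
  rw [norm_mul, norm_neg, norm_one] at h1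
  have h2 : ‖t‖ * ‖MvPolynomial.eval x Q / MvPolynomial.eval x D‖ ≤ (|B| + 1)⁻¹ * |B| :=
    mul_le_mul ht ((hB x hx).trans (le_abs_self B)) (norm_nonneg _) (by positivity)
  have h3 : (|B| + 1)⁻¹ * |B| < 1 := by
    rw [inv_mul_lt_iff₀ (by positivity)]
    linarith
  linarith

end SymBidisc

end

/-! ### The perturbation of `f` -/

theorem mainTheorem7 (ξ η : SymBidisc.Poly2) (m : ℕ) (f : SymBidisc.Rat2)
    (hirr : SymBidisc.IsIrreducibleVariety (SymBidisc.zeroSet ξ))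
    (hdist : SymBidisc.IsDistinguished (SymBidisc.zeroSet ξ))
    (hf : SymBidisc.IsRegularRationalInner f)
    (hη : η ≠ 0)
    (hform : SymBidisc.ratCompPi f = SymBidisc.blaschkeForm m η)
    (hdeg : SymBidisc.twoDeg (SymBidisc.compPi ξ) ≤
      SymBidisc.ratTwoDeg (SymBidisc.ratCompPi f)) :
    ∀ x ∈ SymBidisc.G \ (SymBidisc.G ∩ SymBidisc.zeroSet ξ),
      ∃ g : SymBidisc.Rat2, SymBidisc.IsRegularRationalInner g ∧
        (∀ y ∈ SymBidisc.zeroSet ξ ∩ SymBidisc.G,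
          SymBidisc.ratEval g y = SymBidisc.ratEval f y) ∧
        SymBidisc.ratEval g x ≠ SymBidisc.ratEval f x := by
  open SymBidisc in
  rintro x ⟨hxG, hxW⟩
  have hξ0 := ne_zero_of_isDistinguished hdist
  obtain ⟨F, hF, hFξ, hFW⟩ := exists_prime_dvd_zeroSet_eq hξ0 hirr
  rw [← hFW] at hdist hxW ⊢
  obtain ⟨κ, hκ, hκF⟩ := refl_eq_C_mul_of_dvd hF.ne_zero (dvd_refl_of_isDistinguished hF hdist)
  have hxF : MvPolynomial.eval x F ≠ 0 := fun h => hxW ⟨hxG, h⟩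
  set N := ratNum f with hN
  set D := ratDen f with hDdef
  have hD : ∀ y ∈ closure G, MvPolynomial.eval y D ≠ 0 := hf.1
  have h00 : (0 : C2) ∈ G := ⟨0, 0, by simp, by simp, by
    ext i; fin_cases i <;> simp [symMap]⟩
  have hND : ∀ y ∈ bG, ‖MvPolynomial.eval y N‖ = ‖MvPolynomial.eval y D‖ :=
    fun y hy => norm_eval_eq_of_isInner hf hy
  obtain ⟨-, c, hc, hcN⟩ := eval_num_eq_of_norm_eq (isRelPrime_num_den f)
    (fun y hy => hD y (bG_subset_closure_G hy)) (hD 0 (subset_closure h00)) hND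
  have hN0 : N ≠ 0 := by
    have h11 := symMap_mem_bG (z := 1) (w := 1) (by simp) (by simp)
    intro h
    have := hND _ h11
    rw [h, map_zero, norm_zero, eq_comm, norm_eq_zero] at this
    exact hD _ (bG_subset_closure_G h11) this
  have hdle : F.totalDegree ≤ N.totalDegree := by
    have h1 : ξ.totalDegree ≤ N.totalDegree := by
      rw [← degreeOf_compPi ξ]
      exact hdeg.1.trans (ratTwoDeg_ratCompPi_fst_le hN0)
    refine le_trans ?_ h1
    obtain ⟨u, rfl⟩ := hFξ
    rw [MvPolynomial.totalDegree_mul_of_isDomain hF.ne_zero (right_ne_zero_of_mul hξ0)]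
    exact Nat.le_add_right _ _
  -- This exponent makes `p ^ n * conj (p ^ k * F)` equal to `p ^ deg F * conj F = κ * F` on `bG`.
  set k := N.totalDegree - F.totalDegree with hk
  set Q : Poly2 := MvPolynomial.X 1 ^ k * F with hQ
  obtain ⟨ε, hε, hεD⟩ := exists_pos_forall_eval_add_ne_zero (Q := Q) hD
  have hinner : ∀ t : ℂ, ‖t‖ ≤ ε → IsRegularRationalInner
      (algebraMap Poly2 Rat2 (N + MvPolynomial.C (c * starRingEnd ℂ t * κ) * F) /
        algebraMap Poly2 Rat2 (D + MvPolynomial.C t * Q)) := by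
    intro t ht
    refine isRegularRationalInner_div (hεD t ht) fun y hy => ?_
    have e1 := hcN y hy
    have e2 : κ * MvPolynomial.eval y F =
        y 1 ^ F.totalDegree * starRingEnd ℂ (MvPolynomial.eval y F) := by
      rw [← eval_refl le_rfl hy, hκF, map_mul, MvPolynomial.eval_C]
    have e3 : y 1 ^ F.totalDegree = y 1 ^ N.totalDegree * starRingEnd ℂ (y 1 ^ k) := by
      rw [hk, ← Nat.sub_add_cancel hdle, Nat.add_sub_cancel, pow_add, map_pow,
        mul_right_comm, ← mul_pow, (conj_symm_of_mem_bG hy).1, one_pow, one_mul]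
    have e4 : MvPolynomial.eval y (N + MvPolynomial.C (c * starRingEnd ℂ t * κ) * F) =
        c * (y 1 ^ N.totalDegree *
          starRingEnd ℂ (MvPolynomial.eval y (D + MvPolynomial.C t * Q))) := by
      rw [e3] at e2
      simp only [hQ, map_add, map_mul, MvPolynomial.eval_C, map_pow, MvPolynomial.eval_X] at e2 ⊢
      linear_combination e1 + c * starRingEnd ℂ t * e2
    rw [e4, norm_mul, norm_mul, norm_pow, hc, norm_snd_of_mem_bG hy, RCLike.norm_conj,
      one_pow, one_mul, one_mul]
  have hval : ∀ t : ℂ, ‖t‖ ≤ ε → ∀ y ∈ closure G, ratEval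
      (algebraMap Poly2 Rat2 (N + MvPolynomial.C (c * starRingEnd ℂ t * κ) * F) /
        algebraMap Poly2 Rat2 (D + MvPolynomial.C t * Q)) y =
      (MvPolynomial.eval y N + c * starRingEnd ℂ t * κ * MvPolynomial.eval y F) /
        (MvPolynomial.eval y D + t * (y 1 ^ k * MvPolynomial.eval y F)) := by
    intro t ht y hy
    rw [ratEval_div (hεD t ht y hy)]
    simp [hQ]
  -- This is `g x ≠ f x` after cross-multiplying and cancelling `F x`. One side is conjugate-linear
  -- in `t` and the other linear, so equality at both `t = ε` and `t = ε * I` would force `D x = 0`.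
  have hex : ∃ t : ℂ, ‖t‖ ≤ ε ∧
      c * starRingEnd ℂ t * κ * MvPolynomial.eval x D ≠ t * x 1 ^ k * MvPolynomial.eval x N := by
    by_contra! hall
    have a1 := hall ε (by simp [abs_of_pos hε])
    have a2 := hall (ε * Complex.I) (by simp [abs_of_pos hε])
    simp only [map_mul, Complex.conj_ofReal, Complex.conj_I] at a1 a2
    have hc0 : c ≠ 0 := by rintro rfl; simp at hc
    have hε0 : (ε : ℂ) ≠ 0 := by exact_mod_cast hε.ne'
    have : 2 * (c * ε * κ * MvPolynomial.eval x D) = 0 := by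
      linear_combination a1 + Complex.I * a2 + (c * ε * κ * MvPolynomial.eval x D +
        ε * x 1 ^ k * MvPolynomial.eval x N) * Complex.I_sq
    simp [hc0, hε0, hκ, hD x (subset_closure hxG)] at this
  obtain ⟨t, ht, hne⟩ := hex
  refine ⟨_, hinner t ht, ?_, ?_⟩
  · rintro y ⟨hyW, hyG⟩
    have hyF : MvPolynomial.eval y F = 0 := hyW
    rw [hval t ht y (subset_closure hyG), hyF, mul_zero, mul_zero, mul_zero, add_zero, add_zero]
    rfl
  · have hden := hεD t ht x (subset_closure hxG)
    rw [hval t ht x (subset_closure hxG), ratEval]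
    simp only [hQ, map_add, map_mul, MvPolynomial.eval_C, map_pow, MvPolynomial.eval_X] at hden
    rw [Ne, div_eq_div_iff hden (hD x (subset_closure hxG))]
    intro h
    apply hne
    apply mul_right_cancel₀ hxF
    linear_combination h
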